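/- Let $(Q,h)$ be a pointed quandle, that is, a quandle $Q$ (a set with a binary operation $*$ such that $a*a=a$; for all $a,b\in Q$ there is a unique element $a\,\bar{*}\,b\in Q$ with $a=(a\,\bar{*}\,b)*b=(a*b)\,\bar{*}\,b$; and $(a*b)*c=(a*c)*(b*c)$) together with an element $h\in Q$. Let $n$ be a natural number, let $Q^{*n}=Q_1*\cdots*Q_n$ be the free product (the coproduct in the category of quandles) of $n$ copies of $Q$, and for $q\in Q$ let $q_i\in Q^{*n}$ be the element corresponding to $q$ in the $i$-th copy. Let $B_n$ be the braid group on $n$ strands with standard generators $\sigma_1,\dots,\sigma_{n-1}$, and let $\rho_{Q,h}\colon B_n\to\operatorname{Aut}(Q^{*n})$ be the group homomorphism that sends $\sigma_k$ to the automorphism $\tau_k$ given by $$\tau_k(q_k)=q_{k+1}\,\bar{*}\,h_k,\qquad \tau_k(q_{k+1})=q_k*h_k,\qquad \tau_k(q_i)=q_i\quad(i\neq k,k+1)$$ for all $q\in Q$. Then $\rho_{Q,h}$ is faithful, i.e. injective. -/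

import Mathlib

universe u v w

/-
Quandles are Mathlib's `Quandle`, written as a left action.  The right-handed operations are
`a * b = b ◃ a` and (inverse operation) `b ◃⁻¹ a`; under this dictionary the axioms
`a * a = a`, right invertibility and `(a * b) * c = (a * c) * (b * c)` are those of `Quandle`.
Morphisms of quandles are Mathlib's `ShelfHom`.
-/

/-- The group of automorphisms of a quandle: the bijections that preserve the operation,
with composition of maps as multiplication. -/
def quandleAut (Q : Type u) [Quandle Q] : Subgroup (Equiv.Perm Q) where
  carrier := {f | ∀ x y : Q, f (Shelf.act x y) = Shelf.act (f x) (f y)}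
  mul_mem' := by
    intro f g hf hg x y
    have h1 := hg x y
    have h2 := hf (g x) (g y)
    simp only [Equiv.Perm.mul_apply, h1, h2]
  one_mem' := by
    intro x y
    rfl
  inv_mem' := by
    intro f hf x y
    apply f.injective
    have h1 : f (Shelf.act (f.symm x) (f.symm y)) =
        Shelf.act (f (f.symm x)) (f (f.symm y)) := hf _ _
    rw [f.apply_symm_apply, f.apply_symm_apply] at h1
    exact (f.apply_symm_apply _).trans h1.symm

/-! ### The free product of a family of quandles -/

namespace QuandleFreeProd

open Quandles

/-- Formal expressions in the elements of the quandles `Q i` and the two operations. -/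
inductive Term {ι : Type u} (Q : ι → Type v) : Type (max u v)
  | of (i : ι) (q : Q i) : Term Q
  | act (a b : Term Q) : Term Q
  | invAct (a b : Term Q) : Term Q

/-- The smallest congruence on formal expressions that contains the quandle axioms and the
operation tables of all the `Q i`. -/
inductive Rel {ι : Type u} (Q : ι → Type v) [∀ i, Quandle (Q i)] : Term Q → Term Q → Prop
  | refl (a : Term Q) : Rel Q a a
  | symm {a b : Term Q} (hab : Rel Q a b) : Rel Q b a
  | trans {a b c : Term Q} (hab : Rel Q a b) (hbc : Rel Q b c) : Rel Q a c
  | congr_act {a a' b b' : Term Q} (ha : Rel Q a a') (hb : Rel Q b b') :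
      Rel Q (.act a b) (.act a' b')
  | congr_invAct {a a' b b' : Term Q} (ha : Rel Q a a') (hb : Rel Q b b') :
      Rel Q (.invAct a b) (.invAct a' b')
  | self_distrib (a b c : Term Q) :
      Rel Q (.act a (.act b c)) (.act (.act a b) (.act a c))
  | invAct_act (a b : Term Q) : Rel Q (.invAct a (.act a b)) b
  | act_invAct (a b : Term Q) : Rel Q (.act a (.invAct a b)) b
  | fix (a : Term Q) : Rel Q (.act a a) a
  | of_act (i : ι) (x y : Q i) : Rel Q (.of i (x ◃ y)) (.act (.of i x) (.of i y))

/-- The congruence, as a setoid. -/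
def termSetoid {ι : Type u} (Q : ι → Type v) [∀ i, Quandle (Q i)] : Setoid (Term Q) where
  r := Rel Q
  iseqv := ⟨Rel.refl, Rel.symm, Rel.trans⟩

end QuandleFreeProd

/-- The free product (coproduct in the category of quandles) of the family `Q`. -/
def QuandleFreeProd {ι : Type u} (Q : ι → Type v) [∀ i, Quandle (Q i)] : Type (max u v) :=
  Quotient (QuandleFreeProd.termSetoid Q)

namespace QuandleFreeProd

open Quandles

instance instQuandle {ι : Type u} (Q : ι → Type v) [∀ i, Quandle (Q i)] :
    Quandle (QuandleFreeProd Q) where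
  act := Quotient.map₂ Term.act fun _ _ ha _ _ hb => Rel.congr_act ha hb
  invAct := Quotient.map₂ Term.invAct fun _ _ ha _ _ hb => Rel.congr_invAct ha hb
  self_distrib := by
    rintro ⟨a⟩ ⟨b⟩ ⟨c⟩
    exact Quotient.sound (Rel.self_distrib a b c)
  left_inv := by
    rintro ⟨a⟩ ⟨b⟩
    exact Quotient.sound (Rel.invAct_act a b)
  right_inv := by
    rintro ⟨a⟩ ⟨b⟩
    exact Quotient.sound (Rel.act_invAct a b)
  fix := by
    rintro ⟨a⟩
    exact Quotient.sound (Rel.fix a)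

/-- The canonical morphism of the factor `Q i` to the free product. -/
def of {ι : Type u} {Q : ι → Type v} [∀ i, Quandle (Q i)] (i : ι) :
    Q i →◃ QuandleFreeProd Q where
  toFun q := Quotient.mk (termSetoid Q) (Term.of i q)
  map_act' := by
    intro x y
    exact Quotient.sound (Rel.of_act i x y)

theorem map_invAct {S : Type u} {T : Type v} [Quandle S] [Quandle T] (f : S →◃ T) (x y : S) :
    f (x ◃⁻¹ y) = f x ◃⁻¹ f y := by
  rw [← Rack.left_cancel (f x), ← f.map_act, Rack.act_invAct_eq, Rack.act_invAct_eq]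

/-- Evaluation of formal expressions along a family of morphisms. -/
def evalAux {ι : Type u} {Q : ι → Type v} [∀ i, Quandle (Q i)] {S : Type w} [Quandle S]
    (f : ∀ i, Q i →◃ S) : Term Q → S
  | .of i q => f i q
  | .act a b => evalAux f a ◃ evalAux f b
  | .invAct a b => evalAux f a ◃⁻¹ evalAux f b

theorem evalAux_eq {ι : Type u} {Q : ι → Type v} [∀ i, Quandle (Q i)] {S : Type w} [Quandle S]
    (f : ∀ i, Q i →◃ S) {a b : Term Q} (hab : Rel Q a b) : evalAux f a = evalAux f b := by
  induction hab with
  | refl a => rfl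
  | symm _ ih => exact ih.symm
  | trans _ _ ih1 ih2 => exact ih1.trans ih2
  | congr_act _ _ ih1 ih2 => simp only [evalAux, ih1, ih2]
  | congr_invAct _ _ ih1 ih2 => simp only [evalAux, ih1, ih2]
  | self_distrib a b c => exact Shelf.self_distrib
  | invAct_act a b => exact Rack.invAct_act_eq _ _
  | act_invAct a b => exact Rack.act_invAct_eq _ _
  | fix a => exact Quandle.fix
  | of_act i x y => exact (f i).map_act

/-- The universal property, existence: a family of morphisms `Q i → S` extends to the
free product. -/
def lift {ι : Type u} {Q : ι → Type v} [∀ i, Quandle (Q i)] {S : Type w} [Quandle S]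
    (f : ∀ i, Q i →◃ S) : QuandleFreeProd Q →◃ S where
  toFun := Quotient.lift (evalAux f) fun _ _ hab => evalAux_eq f hab
  map_act' := by
    rintro ⟨a⟩ ⟨b⟩
    rfl

theorem lift_of {ι : Type u} {Q : ι → Type v} [∀ i, Quandle (Q i)] {S : Type w} [Quandle S]
    (f : ∀ i, Q i →◃ S) (i : ι) (q : Q i) : lift f (of i q) = f i q :=
  rfl

/-- The universal property, uniqueness. -/
theorem hom_ext {ι : Type u} {Q : ι → Type v} [∀ i, Quandle (Q i)] {S : Type w} [Quandle S]
    (f g : QuandleFreeProd Q →◃ S) (hfg : ∀ i (q : Q i), f (of i q) = g (of i q)) :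
    ∀ x, f x = g x := by
  rintro ⟨a⟩
  induction a with
  | of i q => exact hfg i q
  | act a b iha ihb =>
    have h1 := f.map_act (x := Quotient.mk (termSetoid Q) a) (y := Quotient.mk (termSetoid Q) b)
    have h2 := g.map_act (x := Quotient.mk (termSetoid Q) a) (y := Quotient.mk (termSetoid Q) b)
    exact h1.trans ((congrArg₂ Shelf.act iha ihb).trans h2.symm)
  | invAct a b iha ihb =>
    have h1 := map_invAct f (Quotient.mk (termSetoid Q) a) (Quotient.mk (termSetoid Q) b)
    have h2 := map_invAct g (Quotient.mk (termSetoid Q) a) (Quotient.mk (termSetoid Q) b)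
    exact h1.trans ((congrArg₂ Rack.invAct iha ihb).trans h2.symm)

end QuandleFreeProd

/-! ### The braid group -/

/-- Artin's relations for the braid group on `n` strands, between the generators
`σ_0, …, σ_{n-2}`. -/
def braidRels (n : ℕ) : Set (FreeGroup (Fin (n - 1))) :=
  {r | (∃ i j : Fin (n - 1), (i : ℕ) + 1 = j ∧
          r = FreeGroup.of i * FreeGroup.of j * FreeGroup.of i *
            (FreeGroup.of j * FreeGroup.of i * FreeGroup.of j)⁻¹) ∨
       (∃ i j : Fin (n - 1), (i : ℕ) + 2 ≤ j ∧
          r = FreeGroup.of i * FreeGroup.of j * (FreeGroup.of j * FreeGroup.of i)⁻¹)}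

/-- The braid group `B_n`, by Artin's presentation. -/
abbrev BraidGroup (n : ℕ) : Type := PresentedGroup (braidRels n)

/-- The standard generators of `B_n`. -/
def braidSigma {n : ℕ} (k : Fin (n - 1)) : BraidGroup n := PresentedGroup.of k

/-! ### The representation associated to a pointed quandle -/

/-- The free product `Q^{*n}` of `n` copies of `Q`. -/
abbrev QuandlePower (Q : Type u) [Quandle Q] (n : ℕ) : Type u :=
  QuandleFreeProd (fun _ : Fin n => Q)

namespace QuandlePower

open Quandles

/-- The element `q_i` of the `i`-th copy of `Q` in `Q^{*n}`. -/
def copy {Q : Type u} [Quandle Q] {n : ℕ} (i : Fin n) (q : Q) : QuandlePower Q n :=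
  QuandleFreeProd.of (Q := fun _ : Fin n => Q) i q

theorem copy_act {Q : Type u} [Quandle Q] {n : ℕ} (i : Fin n) (x y : Q) :
    copy i (x ◃ y) = copy i x ◃ copy i y :=
  (QuandleFreeProd.of (Q := fun _ : Fin n => Q) i).map_act

/-- The index `k` of the left strand of the generator `σ_k`. -/
def lo {n : ℕ} (k : Fin (n - 1)) : Fin n := ⟨k, by omega⟩

/-- The index `k + 1` of the right strand of the generator `σ_k`. -/
def hi {n : ℕ} (k : Fin (n - 1)) : Fin n := ⟨k + 1, by omega⟩

theorem lo_ne_hi {n : ℕ} (k : Fin (n - 1)) : lo k ≠ hi k := by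
  intro h
  have := congrArg Fin.val h
  simp [lo, hi] at this

/-- The images of the `q_i` under `τ_k`: `q_k ↦ h_k ◃⁻¹ q_{k+1}`, `q_{k+1} ↦ h_k ◃ q_k`, and
`q_i ↦ q_i` otherwise. -/
def tauFun {Q : Type u} [Quandle Q] (h : Q) {n : ℕ} (k : Fin (n - 1)) (i : Fin n) (q : Q) :
    QuandlePower Q n :=
  if i = lo k then copy (lo k) h ◃⁻¹ copy (hi k) q
  else if i = hi k then copy (lo k) h ◃ copy (lo k) q
  else copy i q

/-- The images of the `q_i` under the inverse of `τ_k`: `q_k ↦ h_{k+1} ◃⁻¹ q_{k+1}`,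
`q_{k+1} ↦ h_{k+1} ◃ q_k`, and `q_i ↦ q_i` otherwise. -/
def tauInvFun {Q : Type u} [Quandle Q] (h : Q) {n : ℕ} (k : Fin (n - 1)) (i : Fin n) (q : Q) :
    QuandlePower Q n :=
  if i = lo k then copy (hi k) h ◃⁻¹ copy (hi k) q
  else if i = hi k then copy (hi k) h ◃ copy (lo k) q
  else copy i q

theorem invAct_distrib {S : Type u} [Quandle S] (a x y : S) :
    a ◃⁻¹ (x ◃ y) = (a ◃⁻¹ x) ◃ (a ◃⁻¹ y) := by
  rw [← Rack.left_cancel a, Shelf.self_distrib]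
  simp only [Rack.act_invAct_eq]

theorem invAct_act_left {S : Type u} [Quandle S] (a b c : S) :
    (a ◃⁻¹ b) ◃ c = a ◃⁻¹ (b ◃ (a ◃ c)) := by
  rw [invAct_distrib, Rack.invAct_act_eq]

theorem invAct_invAct_left {S : Type u} [Quandle S] (a b c : S) :
    (a ◃⁻¹ b) ◃⁻¹ c = a ◃⁻¹ (b ◃⁻¹ (a ◃ c)) := by
  rw [← Rack.left_cancel (a ◃⁻¹ b), Rack.act_invAct_eq, invAct_act_left]
  simp only [Rack.act_invAct_eq, Rack.invAct_act_eq]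

/-- `τ_k` as an endomorphism of `Q^{*n}`. -/
def tauHom {Q : Type u} [Quandle Q] (h : Q) {n : ℕ} (k : Fin (n - 1)) :
    QuandlePower Q n →◃ QuandlePower Q n :=
  QuandleFreeProd.lift fun i =>
    { toFun := tauFun h k i
      map_act' := by
        intro x y
        unfold tauFun
        split_ifs
        · rw [copy_act, invAct_distrib]
        · rw [copy_act, Shelf.self_distrib]
        · rw [copy_act] }

/-- The inverse of `τ_k` as an endomorphism of `Q^{*n}`. -/
def tauInvHom {Q : Type u} [Quandle Q] (h : Q) {n : ℕ} (k : Fin (n - 1)) :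
    QuandlePower Q n →◃ QuandlePower Q n :=
  QuandleFreeProd.lift fun i =>
    { toFun := tauInvFun h k i
      map_act' := by
        intro x y
        unfold tauInvFun
        split_ifs
        · rw [copy_act, invAct_distrib]
        · rw [copy_act, Shelf.self_distrib]
        · rw [copy_act] }

section Computation

variable {Q : Type u} [Quandle Q] (h : Q) {n : ℕ} (k : Fin (n - 1))

theorem tauHom_lo (q : Q) :
    tauHom h k (copy (lo k) q) = copy (lo k) h ◃⁻¹ copy (hi k) q := by
  change tauFun h k (lo k) q = _
  simp [tauFun]

theorem tauHom_hi (q : Q) :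
    tauHom h k (copy (hi k) q) = copy (lo k) h ◃ copy (lo k) q := by
  change tauFun h k (hi k) q = _
  simp [tauFun, (lo_ne_hi k).symm]

theorem tauHom_ne (q : Q) (i : Fin n) (h1 : i ≠ lo k) (h2 : i ≠ hi k) :
    tauHom h k (copy i q) = copy i q := by
  change tauFun h k i q = _
  simp [tauFun, h1, h2]

theorem tauInvHom_lo (q : Q) :
    tauInvHom h k (copy (lo k) q) = copy (hi k) h ◃⁻¹ copy (hi k) q := by
  change tauInvFun h k (lo k) q = _
  simp [tauInvFun]

theorem tauInvHom_hi (q : Q) :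
    tauInvHom h k (copy (hi k) q) = copy (hi k) h ◃ copy (lo k) q := by
  change tauInvFun h k (hi k) q = _
  simp [tauInvFun, (lo_ne_hi k).symm]

theorem tauInvHom_ne (q : Q) (i : Fin n) (h1 : i ≠ lo k) (h2 : i ≠ hi k) :
    tauInvHom h k (copy i q) = copy i q := by
  change tauInvFun h k i q = _
  simp [tauInvFun, h1, h2]

theorem hom_ext {S : Type v} [Quandle S] (f g : QuandlePower Q n →◃ S)
    (hfg : ∀ i q, f (copy i q) = g (copy i q)) : ∀ x, f x = g x :=
  QuandleFreeProd.hom_ext f g hfg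

theorem tauInv_tau (x : QuandlePower Q n) : tauInvHom h k (tauHom h k x) = x := by
  refine hom_ext ((tauInvHom h k).comp (tauHom h k)) (ShelfHom.id _) (fun i q => ?_) x
  change tauInvHom h k (tauHom h k (copy i q)) = copy i q
  by_cases h1 : i = lo k
  · subst h1
    rw [tauHom_lo, QuandleFreeProd.map_invAct, tauInvHom_lo, tauInvHom_hi, Quandle.fix_inv,
      Rack.invAct_act_eq]
  by_cases h2 : i = hi k
  · subst h2
    rw [tauHom_hi, ShelfHom.map_act, tauInvHom_lo, tauInvHom_lo, Quandle.fix_inv,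
      Rack.act_invAct_eq]
  · rw [tauHom_ne _ _ _ _ h1 h2, tauInvHom_ne _ _ _ _ h1 h2]

theorem tau_tauInv (x : QuandlePower Q n) : tauHom h k (tauInvHom h k x) = x := by
  refine hom_ext ((tauHom h k).comp (tauInvHom h k)) (ShelfHom.id _) (fun i q => ?_) x
  change tauHom h k (tauInvHom h k (copy i q)) = copy i q
  by_cases h1 : i = lo k
  · subst h1
    rw [tauInvHom_lo, QuandleFreeProd.map_invAct, tauHom_hi, tauHom_hi, Quandle.fix,
      Rack.invAct_act_eq]
  by_cases h2 : i = hi k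
  · subst h2
    rw [tauInvHom_hi, ShelfHom.map_act, tauHom_lo, tauHom_hi, Quandle.fix,
      Rack.act_invAct_eq]
  · rw [tauInvHom_ne _ _ _ _ h1 h2, tauHom_ne _ _ _ _ h1 h2]

end Computation

/-- The automorphism `τ_k` of `Q^{*n}`. -/
def tau {Q : Type u} [Quandle Q] (h : Q) {n : ℕ} (k : Fin (n - 1)) :
    quandleAut (QuandlePower Q n) :=
  ⟨{ toFun := tauHom h k
     invFun := tauInvHom h k
     left_inv := tauInv_tau h k
     right_inv := tau_tauInv h k }, fun _ _ => (tauHom h k).map_act⟩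

theorem tau_braid {Q : Type u} [Quandle Q] (h : Q) {n : ℕ} (i j : Fin (n - 1))
    (hij : (i : ℕ) + 1 = j) :
    tau h i * tau h j * tau h i = tau h j * tau h i * tau h j := by
  apply Subtype.ext
  apply Equiv.ext
  intro x
  refine hom_ext (((tauHom h i).comp (tauHom h j)).comp (tauHom h i))
    (((tauHom h j).comp (tauHom h i)).comp (tauHom h j)) (fun m q => ?_) x
  simp only [ShelfHom.comp_apply]
  have e : lo j = hi i := by
    apply Fin.ext
    simp only [lo, hi]
    omega
  have n1 : lo i ≠ hi i := lo_ne_hi i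
  have n2 : hi i ≠ hi j := e ▸ lo_ne_hi j
  have n3 : lo i ≠ hi j := by
    intro hh
    have := congrArg Fin.val hh
    simp only [lo, hi] at this
    omega
  have a1 := tauHom_lo h i
  have a2 := tauHom_hi h i
  have a3 := fun q => tauHom_ne h i q (hi j) n3.symm n2.symm
  have b1 := tauHom_lo h j
  have b2 := tauHom_hi h j
  have b3 := fun q => tauHom_ne h j q (lo i) (e ▸ n1) n3
  rw [e] at b1 b2
  by_cases h1 : m = lo i
  · subst h1
    simp only [a1, a2, a3, b1, b3, QuandleFreeProd.map_invAct, invAct_invAct_left,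
      Rack.act_invAct_eq, Quandle.fix]
  by_cases h2 : m = hi i
  · subst h2
    simp only [a1, a2, a3, b1, b2, b3, QuandleFreeProd.map_invAct, ShelfHom.map_act,
      invAct_act_left, Rack.act_invAct_eq, Quandle.fix]
  by_cases h3 : m = hi j
  · subst h3
    simp only [a2, a3, b2, b3, ShelfHom.map_act, Quandle.fix]
  · rw [tauHom_ne h i q m h1 h2, tauHom_ne h j q m (e ▸ h2) h3, tauHom_ne h i q m h1 h2,
      tauHom_ne h j q m (e ▸ h2) h3]

theorem tau_comm {Q : Type u} [Quandle Q] (h : Q) {n : ℕ} (i j : Fin (n - 1))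
    (hij : (i : ℕ) + 2 ≤ j) : tau h i * tau h j = tau h j * tau h i := by
  apply Subtype.ext
  apply Equiv.ext
  intro x
  refine hom_ext ((tauHom h i).comp (tauHom h j)) ((tauHom h j).comp (tauHom h i))
    (fun m q => ?_) x
  simp only [ShelfHom.comp_apply]
  have n1 : lo i ≠ lo j := by simp only [lo, ne_eq, Fin.mk.injEq]; omega
  have n2 : lo i ≠ hi j := by simp only [lo, hi, ne_eq, Fin.mk.injEq]; omega
  have n3 : hi i ≠ lo j := by simp only [lo, hi, ne_eq, Fin.mk.injEq]; omega
  have n4 : hi i ≠ hi j := by simp only [hi, ne_eq, Fin.mk.injEq]; omega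
  have a1 := tauHom_lo h i
  have a2 := tauHom_hi h i
  have a3 := fun q => tauHom_ne h i q (lo j) n1.symm n3.symm
  have a4 := fun q => tauHom_ne h i q (hi j) n2.symm n4.symm
  have b1 := tauHom_lo h j
  have b2 := tauHom_hi h j
  have b3 := fun q => tauHom_ne h j q (lo i) n1 n2
  have b4 := fun q => tauHom_ne h j q (hi i) n3 n4
  by_cases h1 : m = lo i
  · subst h1
    simp only [a1, b3, b4, QuandleFreeProd.map_invAct]
  by_cases h2 : m = hi i
  · subst h2
    simp only [a2, b3, b4, ShelfHom.map_act]
  by_cases h3 : m = lo j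
  · subst h3
    simp only [b1, a3, a4, QuandleFreeProd.map_invAct]
  by_cases h4 : m = hi j
  · subst h4
    simp only [b2, a3, a4, ShelfHom.map_act]
  · rw [tauHom_ne h i q m h1 h2, tauHom_ne h j q m h3 h4, tauHom_ne h i q m h1 h2]

theorem tau_rels {Q : Type u} [Quandle Q] (h : Q) (n : ℕ) :
    ∀ r ∈ braidRels n, FreeGroup.lift (fun k : Fin (n - 1) => tau h k) r = 1 := by
  rintro r (⟨i, j, hij, rfl⟩ | ⟨i, j, hij, rfl⟩)
  · simp only [map_mul, map_inv, FreeGroup.lift_apply_of]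
    rw [mul_inv_eq_one]
    exact tau_braid h i j hij
  · simp only [map_mul, map_inv, FreeGroup.lift_apply_of]
    rw [mul_inv_eq_one]
    exact tau_comm h i j hij

end QuandlePower

/-- The representation `ρ_{Q,h} : B_n → Aut(Q^{*n})`, `σ_k ↦ τ_k`, associated to the pointed
quandle `(Q, h)`. -/
def pointedQuandleRep {Q : Type u} [Quandle Q] (h : Q) (n : ℕ) :
    BraidGroup n →* quandleAut (QuandlePower Q n) :=
  PresentedGroup.toGroup (QuandlePower.tau_rels h n)

theorem pointedQuandleRep_sigma {Q : Type u} [Quandle Q] (h : Q) (n : ℕ) (k : Fin (n - 1)) :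
    pointedQuandleRep h n (braidSigma k) = QuandlePower.tau h k :=
  PresentedGroup.toGroup.of (QuandlePower.tau_rels h n)

/-! Collapsing the `i`-th copy of `Q` to the free generator `x_i` gives a quandle morphism from
`Q^{*n}` to the conjugation quandle of a free group. It is well defined because `x_i ◃ x_i = x_i`,
and it turns `τ_k` into Artin's automorphism (`toFreeGroup_rep`). A braid acting trivially on
`Q^{*n}` therefore acts trivially on the free group, and the claim reduces to Artin's theorem
`Artin.eq_one_of_rep_eq_one`.

Artin's theorem goes by induction on the number of strands, here `m + 2`, numbered from `0`. Let `H`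
be generated by the `σ_k` with `k < m`, and `L` by the loops of the last strand around the others.
`H` normalizes `L`, so `L ⊔ H = L H`, and the products `σ_j ⋯ σ_m` with `j ≤ m + 1` represent all
its left cosets (`exists_run_mul`). Modulo `x_{m+1}`, elements of `L H` send `x_{m+1}` to `1`, while
`σ_j ⋯ σ_m` sends it to `x_j`; so a braid in the kernel lies in `L H`. Write it as `x y`. Since `y`
fixes `x_{m+1}`, so does `x`. A word `w` in the loops sends `x_{m+1}` to `g⁻¹ x_{m+1} g` with `g ≡
w` modulo `x_{m+1}` (`lift_loop_apply`), and whatever commutes with `x_{m+1}` is trivial modulo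
`x_{m+1}` (`kill_eq_one_of_conj_eq`). Hence `w = 1`, the braid is `y ∈ H`, and it comes from one
strand fewer. -/

/-! ### Braid sequences in a group -/

/-- A sequence of elements of a group whose members of index at most `m` satisfy the braid
relations. -/
structure IsBraidSeq {G : Type*} [Group G] (m : ℕ) (s : ℕ → G) : Prop where
  braid : ∀ k, k < m → s k * s (k + 1) * s k = s (k + 1) * s k * s (k + 1)
  comm : ∀ i j, i + 2 ≤ j → j ≤ m → s i * s j = s j * s i

namespace IsBraidSeq

variable {G : Type*} [Group G]

/-- The product `s i * s (i + 1) * ⋯ * s (i + d - 1)`. -/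
def run (s : ℕ → G) (i : ℕ) : ℕ → G
  | 0 => 1
  | d + 1 => s i * run s (i + 1) d

/-- The element `s i * ⋯ * s (m - 1) * (s m) ^ 2 * (s i * ⋯ * s (m - 1))⁻¹`: strand `m + 1`
turns once around strand `i`. -/
def loop (s : ℕ → G) (m i : ℕ) : G := run s i (m - i) * (s m * s m) * (run s i (m - i))⁻¹

theorem loop_self (s : ℕ → G) (m : ℕ) : loop s m m = s m * s m := by
  simp [loop, run]

theorem run_sub (s : ℕ → G) {m i : ℕ} (hi : i < m) :
    run s i (m - i) = s i * run s (i + 1) (m - (i + 1)) := by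
  obtain ⟨d, rfl⟩ := Nat.exists_eq_add_of_lt hi
  rw [show i + d + 1 - i = d + 1 by omega, show i + d + 1 - (i + 1) = d by omega, run]

theorem loop_of_lt (s : ℕ → G) {m i : ℕ} (hi : i < m) :
    loop s m i = s i * loop s m (i + 1) * (s i)⁻¹ := by
  simp only [loop, run_sub s hi]
  group

/-! ### Identities between two braided elements -/

section Elements

variable {a b x : G}

theorem conj_eq_of_braid (h : a * b * a = b * a * b) : b⁻¹ * a * b = a * b * a⁻¹ := by
  rw [eq_mul_inv_iff_mul_eq, mul_assoc, mul_assoc, inv_mul_eq_iff_eq_mul]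
  simpa only [mul_assoc] using h

theorem inv_conj_eq_of_braid (h : a * b * a = b * a * b) : b⁻¹ * a⁻¹ * b = a * b⁻¹ * a⁻¹ := by
  have := congrArg (·⁻¹) (conj_eq_of_braid h)
  simpa [mul_assoc] using this

/-- The product is `(b a)³ a⁻²`, and `(b a)³` is the full twist on three strands, central in the
subgroup generated by `a` and `b`. -/
theorem commute_double_loop_base (h : a * b * a = b * a * b) :
    Commute a (b * b * (a * (b * b) * a⁻¹)) := by
  have key : a * b * b * a * b * b = b * b * a * b * b * a := by
    calc a * b * b * a * b * b = a * b * (b * a * b) * b := by group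
      _ = a * b * (a * b * a) * b := by rw [h]
      _ = (a * b * a) * (b * a * b) := by group
      _ = (b * a * b) * (a * b * a) := by rw [h]
      _ = b * (a * b * a) * b * a := by group
      _ = b * (b * a * b) * b * a := by rw [h]
      _ = b * b * a * b * b * a := by group
  calc a * (b * b * (a * (b * b) * a⁻¹)) = a * b * b * a * b * b * a⁻¹ := by group
    _ = b * b * (a * (b * b) * a⁻¹) * a := by rw [key]; group

/-- The hypothesis `hb` says that `b` commutes with `x b x`. The product in the conclusion equals `b
a (x b x) (a b a)⁻¹`; multiplying by `a` on the left creates a `b` that passes through `x b x` and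
leaves `(a b a)⁻¹` as `a`. -/
theorem commute_double_loop_step (h : a * b * a = b * a * b) (hx : Commute a x)
    (hb : Commute b (x * (b * x * b⁻¹))) :
    Commute a (b * x * b⁻¹ * (a * (b * x * b⁻¹) * a⁻¹)) := by
  have hy : b * (x * b * x) = x * b * x * b := by
    have := hb.eq
    calc b * (x * b * x) = b * (x * (b * x * b⁻¹)) * b := by group
      _ = x * b * x * b := by rw [this]; group
  have e : b * x * b⁻¹ * (a * (b * x * b⁻¹) * a⁻¹) = b * a * (x * b * x) * (a * b * a)⁻¹ := by
    have hx' : a⁻¹ * x = x * a⁻¹ := hx.inv_left.eq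
    calc b * x * b⁻¹ * (a * (b * x * b⁻¹) * a⁻¹)
        = b * x * (b⁻¹ * a * b) * x * b⁻¹ * a⁻¹ := by group
      _ = b * (x * a) * b * (a⁻¹ * x) * b⁻¹ * a⁻¹ := by rw [conj_eq_of_braid h]; group
      _ = b * a * (x * b * x) * (a * b * a)⁻¹ := by rw [← hx.eq, hx']; group
  rw [e]
  calc a * (b * a * (x * b * x) * (a * b * a)⁻¹)
      = (a * b * a) * (x * b * x) * (a * b * a)⁻¹ := by group
    _ = b * a * (b * (x * b * x)) * (b * a * b)⁻¹ := by rw [h]; group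
    _ = b * a * (x * b * x) * (a * b * a)⁻¹ * a := by rw [hy]; group

/-- Conjugation by `a b` carries `a` to `b`, hence carries the relation `hx` to the conclusion. -/
theorem commute_conj_of_braid (h : a * b * a = b * a * b) (hx : Commute a x) :
    Commute b (a * (b * x * b⁻¹) * a⁻¹) := by
  calc b * (a * (b * x * b⁻¹) * a⁻¹) = (b * a * b) * x * b⁻¹ * a⁻¹ := by group
    _ = a * b * (a * x) * b⁻¹ * a⁻¹ := by rw [← h]; group
    _ = a * b * x * (a * b⁻¹ * a⁻¹) := by rw [hx.eq]; group
    _ = a * (b * x * b⁻¹) * a⁻¹ * b := by rw [← inv_conj_eq_of_braid h]; group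

theorem conj_sq_of_braid (h : a * b * a = b * a * b) :
    b⁻¹ * (a * a) * b = a * (b * b) * a⁻¹ := by
  calc b⁻¹ * (a * a) * b = (b⁻¹ * a * b) * (b⁻¹ * a * b) := by group
    _ = a * (b * b) * a⁻¹ := by rw [conj_eq_of_braid h]; group

end Elements

/-! ### Commutation of generators with loops -/

variable {m : ℕ} {s : ℕ → G}

section

variable (hs : IsBraidSeq m s)
include hs

theorem commute_of_le {i j : ℕ} (hij : i + 2 ≤ j) (hj : j ≤ m) : Commute (s i) (s j) :=
  hs.comm i j hij hj

theorem commute_loop_of_le {k i : ℕ} (hk : k + 2 ≤ i) (hi : i ≤ m) :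
    Commute (s k) (loop s m i) := by
  induction hi using Nat.decreasingInduction with
  | self =>
    rw [loop_self]
    exact (hs.commute_of_le hk le_rfl).mul_right (hs.commute_of_le hk le_rfl)
  | of_succ i hi ih =>
    rw [loop_of_lt s hi]
    have := hs.commute_of_le hk hi.le
    exact (this.mul_right (ih (by omega))).mul_right this.inv_right

/-- Geometrically, the last strand encircles strands `i` and `i + 1` together, so a crossing of
these two does not matter. -/
theorem commute_loop_mul_loop {i : ℕ} (hi : i < m) :
    Commute (s i) (loop s m (i + 1) * loop s m i) := by
  obtain ⟨d, rfl⟩ := Nat.exists_eq_add_of_lt hi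
  induction d generalizing i with
  | zero =>
    rw [loop_of_lt s hi]
    simp only [add_zero]
    rw [loop_self]
    exact commute_double_loop_base (hs.braid i hi)
  | succ d ih =>
    have ih' := ih (i := i + 1)
    rw [show i + 1 + d + 1 = i + (d + 1) + 1 by omega] at ih'
    have h2 := ih' hs (by omega)
    rw [loop_of_lt s hi]
    rw [loop_of_lt s (show i + 1 < i + (d + 1) + 1 by omega)] at h2 ⊢
    exact commute_double_loop_step (hs.braid i hi)
      (hs.commute_loop_of_le (by omega) (by omega)) h2

theorem commute_loop_of_lt {i k : ℕ} (hik : i < k) (hk : k < m) :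
    Commute (s k) (loop s m i) := by
  have hik' : i ≤ k - 1 := by omega
  induction hik' using Nat.decreasingInduction with
  | self =>
    obtain ⟨k, rfl⟩ : ∃ l, k = l + 1 := ⟨k - 1, by omega⟩
    rw [Nat.add_sub_cancel, loop_of_lt s (by omega), loop_of_lt s hk]
    exact commute_conj_of_braid (hs.braid k (by omega))
      (hs.commute_loop_of_le (by omega) (by omega))
  | of_succ i hi ih =>
    rw [loop_of_lt s (by omega)]
    have := (hs.commute_of_le (i := i) (j := k) (by omega) hk.le).symm
    exact (this.mul_right (ih (by omega))).mul_right this.inv_right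

theorem commute_run {j i d : ℕ} (hji : j + 2 ≤ i) (hd : i + d ≤ m + 1) :
    Commute (s j) (run s i d) := by
  induction d generalizing i with
  | zero => exact Commute.one_right _
  | succ d ih =>
    exact (hs.commute_of_le hji (by omega)).mul_right (ih (by omega) (by omega))

/-- A second description of the loops, in which strand `j` travels to the last one from the other
side. It identifies the loop that appears when `s j` meets the coset of `run s j` in
`inv_run_mul_mem`. -/
theorem run_conj_sq {j : ℕ} (hj : j ≤ m) :
    (run s (j + 1) (m - j))⁻¹ * (s j * s j) * run s (j + 1) (m - j) = loop s m j := by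
  induction hj using Nat.decreasingInduction with
  | self => simp [run, loop_self]
  | of_succ j hj ih =>
    have hc : Commute (s j) (run s (j + 2) (m - (j + 1))) :=
      hs.commute_run le_rfl (by omega)
    have e : m - j = m - (j + 1) + 1 := by omega
    rw [loop_of_lt s hj, ← ih, e, run]
    set r := run s (j + 2) (m - (j + 1))
    have h1 := conj_sq_of_braid (hs.braid j hj)
    calc (s (j + 1) * r)⁻¹ * (s j * s j) * (s (j + 1) * r)
        = r⁻¹ * ((s (j + 1))⁻¹ * (s j * s j) * s (j + 1)) * r := by group
      _ = (r⁻¹ * s j) * (s (j + 1) * s (j + 1)) * ((s j)⁻¹ * r) := by rw [h1]; group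
      _ = s j * (r⁻¹ * (s (j + 1) * s (j + 1)) * r) * (s j)⁻¹ := by
        rw [← hc.inv_right.eq, hc.inv_left.eq]; group

end

end IsBraidSeq

/-! ### The subgroup of loops, its normalizer, and coset representatives -/

namespace IsBraidSeq

variable {G : Type*} [Group G]

/-- The subgroup generated by the loops of the last strand. -/
def loopSubgroup (s : ℕ → G) (m : ℕ) : Subgroup G := Subgroup.closure {g | ∃ i ≤ m, loop s m i = g}

/-- The subgroup generated by the `s k` with `k < m`. -/
def initSubgroup (s : ℕ → G) (m : ℕ) : Subgroup G := Subgroup.closure {g | ∃ k < m, s k = g}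

theorem loop_mem (s : ℕ → G) {m i : ℕ} (hi : i ≤ m) : loop s m i ∈ loopSubgroup s m :=
  Subgroup.subset_closure ⟨i, hi, rfl⟩

theorem mem_initSubgroup (s : ℕ → G) {m k : ℕ} (hk : k < m) : s k ∈ initSubgroup s m :=
  Subgroup.subset_closure ⟨k, hk, rfl⟩

theorem conj_mem_closure {S : Set G} {c : G} (hS : ∀ g ∈ S, c * g * c⁻¹ ∈ Subgroup.closure S)
    {g : G} (hg : g ∈ Subgroup.closure S) : c * g * c⁻¹ ∈ Subgroup.closure S := by
  have : Subgroup.closure S ≤ (Subgroup.closure S).comap (MulAut.conj c).toMonoidHom :=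
    (Subgroup.closure_le _).2 fun g hg => hS g hg
  exact this hg

variable {m : ℕ} {s : ℕ → G}

section

variable (hs : IsBraidSeq m s)
include hs

theorem conj_loop_mem {k : ℕ} (hk : k < m) {i : ℕ} (hi : i ≤ m) :
    s k * loop s m i * (s k)⁻¹ ∈ loopSubgroup s m := by
  have hone := loop_mem s (show k + 1 ≤ m from hk)
  rcases lt_trichotomy i k with h | rfl | h
  · rw [(hs.commute_loop_of_lt h hk).eq, mul_inv_cancel_right]
    exact loop_mem s hi
  · have h1 := (hs.commute_loop_mul_loop hk).eq
    have h2 := loop_of_lt s hk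
    -- Conjugation by `s i` fixes the product of loops `i + 1` and `i` and turns loop `i + 1` into
    -- loop `i`; this determines its effect on loop `i`.
    have : s i * loop s m i * (s i)⁻¹ = (loop s m i)⁻¹ * loop s m (i + 1) * loop s m i := by
      rw [mul_assoc _ _ (loop s m i), eq_inv_mul_iff_mul_eq, ← mul_inv_eq_iff_eq_mul.2 h1]
      nth_rw 1 [h2]
      group
    rw [this]
    exact mul_mem (mul_mem (inv_mem (loop_mem s hi)) hone) (loop_mem s hi)
  · obtain rfl | h := eq_or_lt_of_le (Nat.succ_le_of_lt h)
    · rw [Nat.succ_eq_add_one, ← loop_of_lt s hk]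
      exact loop_mem s hk.le
    · rw [(hs.commute_loop_of_le h hi).eq, mul_inv_cancel_right]
      exact loop_mem s hi

/-- Needed besides `conj_loop_mem`: in an infinite group, being mapped into itself by conjugation
with `s k` does not put a subgroup's normalizer in possession of `s k`. -/
theorem inv_conj_loop_mem {k : ℕ} (hk : k < m) {i : ℕ} (hi : i ≤ m) :
    (s k)⁻¹ * loop s m i * (s k)⁻¹⁻¹ ∈ loopSubgroup s m := by
  have hone := loop_mem s (show k + 1 ≤ m from hk)
  rw [inv_inv]
  rcases lt_trichotomy i k with h | rfl | h
  · rw [mul_assoc, ← (hs.commute_loop_of_lt h hk).eq, inv_mul_cancel_left]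
    exact loop_mem s hi
  · rw [loop_of_lt s hk]
    convert hone using 1
    group
  · obtain rfl | h := eq_or_lt_of_le (Nat.succ_le_of_lt h)
    · have h1 := (hs.commute_loop_mul_loop hk).eq
      have h2 := loop_of_lt s hk
      have : (s k)⁻¹ * loop s m (k + 1) * s k =
          loop s m (k + 1) * loop s m k * (loop s m (k + 1))⁻¹ := by
        rw [eq_mul_inv_iff_mul_eq, mul_assoc, mul_assoc, inv_mul_eq_iff_eq_mul, h1, mul_assoc]
        congr 1
        rw [h2]
        group
      rw [Nat.succ_eq_add_one, this]
      exact mul_mem (mul_mem hone (loop_mem s hk.le)) (inv_mem hone)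
    · rw [mul_assoc, ← (hs.commute_loop_of_le h hi).eq, inv_mul_cancel_left]
      exact loop_mem s hi

theorem initSubgroup_le_normalizer :
    initSubgroup s m ≤ Subgroup.normalizer (loopSubgroup s m) := by
  refine (Subgroup.closure_le _).2 ?_
  rintro _ ⟨k, hk, rfl⟩
  refine Subgroup.mem_normalizer_iff.2 fun g => ⟨fun hg => ?_, fun hg => ?_⟩
  · refine conj_mem_closure ?_ hg
    rintro _ ⟨i, hi, rfl⟩
    exact hs.conj_loop_mem hk hi
  · have : (s k)⁻¹ * (s k * g * (s k)⁻¹) * (s k)⁻¹⁻¹ ∈ loopSubgroup s m := by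
      refine conj_mem_closure ?_ hg
      rintro _ ⟨i, hi, rfl⟩
      exact hs.inv_conj_loop_mem hk hi
    convert this using 1
    group

theorem exists_mul_of_mem_sup {g : G} (hg : g ∈ loopSubgroup s m ⊔ initSubgroup s m) :
    ∃ x ∈ loopSubgroup s m, ∃ y ∈ initSubgroup s m, x * y = g := by
  have h := Subgroup.coe_mul_of_right_le_normalizer_left (loopSubgroup s m) (initSubgroup s m)
    hs.initSubgroup_le_normalizer
  rw [← SetLike.mem_coe, h] at hg
  exact Set.mem_mul.1 hg

/-- A crossing slides along the strand that passes over the whole block, and its index drops by one.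
-/
theorem mul_run_of_lt {k j : ℕ} (hjk : j < k) (hk : k ≤ m) :
    s k * run s j (m + 1 - j) = run s j (m + 1 - j) * s (k - 1) := by
  obtain ⟨k, rfl⟩ : ∃ l, k = l + 1 := ⟨k - 1, by omega⟩
  rw [Nat.add_sub_cancel]
  have hjk' : j ≤ k := by omega
  induction hjk' using Nat.decreasingInduction with
  | self =>
    have hc := hs.commute_run (j := k) (i := k + 2) (d := m - 1 - k) le_rfl (by omega)
    rw [show m + 1 - k = m - 1 - k + 1 + 1 by omega, run, run]
    calc s (k + 1) * (s k * (s (k + 1) * run s (k + 2) (m - 1 - k)))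
        = s (k + 1) * s k * s (k + 1) * run s (k + 2) (m - 1 - k) := by group
      _ = s k * s (k + 1) * (s k * run s (k + 2) (m - 1 - k)) := by
        rw [← hs.braid k (by omega)]; group
      _ = _ := by rw [hc.eq]; simp only [mul_assoc]
  | of_succ j hj ih =>
    have hc := hs.commute_of_le (i := j) (j := k + 1) (by omega) hk
    have ih := ih (by omega)
    rw [show m + 1 - j = m + 1 - (j + 1) + 1 by omega, run, ← mul_assoc, ← hc.eq, mul_assoc, ih,
      mul_assoc]

/-- Left multiplication by `s k` permutes the cosets of the subgroup that fixes the last strand. -/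
theorem inv_run_mul_mem {k : ℕ} (hk : k ≤ m) {j : ℕ} (hj : j ≤ m + 1) :
    Equiv.swap k (k + 1) j ≤ m + 1 ∧
    (run s (Equiv.swap k (k + 1) j) (m + 1 - Equiv.swap k (k + 1) j))⁻¹ *
      (s k * run s j (m + 1 - j)) ∈ loopSubgroup s m ⊔ initSubgroup s m := by
  by_cases h1 : j = k
  · subst h1
    rw [Equiv.swap_apply_left]
    refine ⟨by omega, ?_⟩
    rw [show m + 1 - j = m - j + 1 by omega, show m + 1 - (j + 1) = m - j by omega, run]
    have := hs.run_conj_sq hk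
    simp only [mul_assoc] at this
    rw [this]
    exact Subgroup.mem_sup_left (loop_mem s hk)
  by_cases h2 : j = k + 1
  · subst h2
    rw [Equiv.swap_apply_right]
    refine ⟨by omega, ?_⟩
    rw [show m + 1 - (k + 1) = m - k by omega, show m + 1 - k = m - k + 1 by omega, run,
      inv_mul_cancel]
    exact one_mem _
  rw [Equiv.swap_apply_of_ne_of_ne h1 h2]
  refine ⟨hj, ?_⟩
  rcases lt_or_gt_of_ne h1 with h | h
  · rw [hs.mul_run_of_lt h hk, inv_mul_cancel_left]
    exact Subgroup.mem_sup_right (mem_initSubgroup s (by omega))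
  · rw [(hs.commute_run (by omega) (by omega) : Commute (s k) (run s j (m + 1 - j))).eq,
      inv_mul_cancel_left]
    exact Subgroup.mem_sup_right (mem_initSubgroup s (by omega))

theorem exists_run_mul {g : G} (hg : g ∈ initSubgroup s (m + 1)) :
    ∃ j ≤ m + 1, (run s j (m + 1 - j))⁻¹ * g ∈ loopSubgroup s m ⊔ initSubgroup s m := by
  induction hg using Subgroup.closure_induction_left with
  | one => exact ⟨m + 1, le_rfl, by simp [run]⟩
  | mul_left x hx y hy ih =>
    obtain ⟨k, hk, rfl⟩ := hx
    obtain ⟨j, hj, h⟩ := ih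
    obtain ⟨h1, h2⟩ := hs.inv_run_mul_mem (k := k) (by omega) hj
    refine ⟨_, h1, ?_⟩
    convert mul_mem h2 h using 1
    group
  | inv_mul_cancel x hx y hy ih =>
    obtain ⟨k, hk, rfl⟩ := hx
    obtain ⟨j, hj, h⟩ := ih
    have hj' := (hs.inv_run_mul_mem (k := k) (by omega) hj).1
    obtain ⟨-, h2⟩ := hs.inv_run_mul_mem (k := k) (by omega) hj'
    -- The permutation of cosets is an involution: `s k` maps the swapped coset back to that of `j`,
    -- so its inverse maps the coset of `j` to the swapped one.
    rw [Equiv.swap_apply_self] at h2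
    refine ⟨_, hj', ?_⟩
    convert mul_mem (inv_mem h2) h using 1
    group

end

end IsBraidSeq

/-! ### Artin's representation -/

namespace Artin

open FreeGroup (of lift)

/-- Artin's automorphism `x_k ↦ x_k⁻¹ x_{k+1} x_k`, `x_{k+1} ↦ x_k` as an endomorphism. -/
def genHom (k : ℕ) : FreeGroup ℕ →* FreeGroup ℕ :=
  lift fun i => if i = k then (of k)⁻¹ * of (k + 1) * of k else if i = k + 1 then of k else of i

/-- The inverse of `genHom`. -/
def genInvHom (k : ℕ) : FreeGroup ℕ →* FreeGroup ℕ :=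
  lift fun i =>
    if i = k then of (k + 1) else if i = k + 1 then of (k + 1) * of k * (of (k + 1))⁻¹ else of i

/-- Artin's automorphism `x_k ↦ x_k⁻¹ x_{k+1} x_k`, `x_{k+1} ↦ x_k` of the free group. -/
def gen (k : ℕ) : MulAut (FreeGroup ℕ) :=
  MonoidHom.toMulEquiv (genHom k) (genInvHom k)
    (by
      ext i
      simp only [genHom, genInvHom, MonoidHom.comp_apply, FreeGroup.lift_apply_of, MonoidHom.id_apply]
      split_ifs with h1 h2
      · simp [h1, mul_assoc]
      · simp [h2]
      · simp [h1, h2])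
    (by
      ext i
      simp only [genHom, genInvHom, MonoidHom.comp_apply, FreeGroup.lift_apply_of, MonoidHom.id_apply]
      split_ifs with h1 h2
      · simp [h1]
      · simp [h2, mul_assoc]
      · simp [h1, h2])

theorem gen_left (k : ℕ) : gen k (of k) = (of k)⁻¹ * of (k + 1) * of k := by
  simp [gen, genHom]

theorem gen_right (k : ℕ) : gen k (of (k + 1)) = of k := by
  simp [gen, genHom]

theorem gen_of_ne {k i : ℕ} (h1 : i ≠ k) (h2 : i ≠ k + 1) : gen k (of i) = of i := by
  simp [gen, genHom, h1, h2]

theorem mulAut_ext {f g : MulAut (FreeGroup ℕ)} (h : ∀ i, f (of i) = g (of i)) : f = g :=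
  MulEquiv.toMonoidHom_injective (FreeGroup.ext_hom _ _ h)

theorem isBraidSeq_gen (m : ℕ) : IsBraidSeq m gen where
  braid k _ := by
    refine mulAut_ext fun i => ?_
    simp only [MulAut.mul_apply]
    by_cases h1 : i = k
    · subst h1
      rw [gen_of_ne (k := i + 1) (i := i) (by omega) (by omega)]
      simp only [gen_left, gen_right, map_mul, map_inv,
        gen_of_ne (k := i + 1) (i := i) (by omega) (by omega),
        gen_of_ne (k := i) (i := i + 1 + 1) (by omega) (by omega)]
      group
    by_cases h2 : i = k + 1
    · subst h2
      simp only [gen_left, gen_right, map_mul, map_inv,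
        gen_of_ne (k := k + 1) (i := k) (by omega) (by omega),
        gen_of_ne (k := k) (i := k + 1 + 1) (by omega) (by omega)]
    by_cases h3 : i = k + 1 + 1
    · subst h3
      simp only [gen_right, gen_of_ne (k := k + 1) (i := k) (by omega) (by omega),
        gen_of_ne (k := k) (i := k + 1 + 1) (by omega) (by omega)]
    · simp only [gen_of_ne h1 h2, gen_of_ne h2 h3]
  comm k l hkl _ := by
    refine mulAut_ext fun i => ?_
    simp only [MulAut.mul_apply]
    by_cases h1 : i = k
    · subst h1
      simp only [gen_left, map_mul, map_inv,
        gen_of_ne (k := l) (i := i) (by omega) (by omega),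
        gen_of_ne (k := l) (i := i + 1) (by omega) (by omega)]
    by_cases h2 : i = k + 1
    · subst h2
      simp only [gen_right, gen_of_ne (k := l) (i := k) (by omega) (by omega),
        gen_of_ne (k := l) (i := k + 1) (by omega) (by omega)]
    by_cases h3 : i = l
    · subst h3
      simp only [gen_left, map_mul, map_inv,
        gen_of_ne (k := k) (i := i) (by omega) (by omega),
        gen_of_ne (k := k) (i := i + 1) (by omega) (by omega)]
    by_cases h4 : i = l + 1
    · subst h4
      simp only [gen_right, gen_of_ne (k := k) (i := l) (by omega) (by omega),
        gen_of_ne (k := k) (i := l + 1) (by omega) (by omega)]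
    · simp only [gen_of_ne h1 h2, gen_of_ne h3 h4]

/-! ### The centralizer of a free generator -/

/-- The endomorphism of the free group that kills the generator `x_p`. -/
def kill (p : ℕ) : FreeGroup ℕ →* FreeGroup ℕ := lift fun i => if i = p then 1 else of i

theorem kill_self (p : ℕ) : kill p (of p) = 1 := by simp [kill]

theorem kill_of_ne {p i : ℕ} (h : i ≠ p) : kill p (of i) = of i := by simp [kill, h]

open Classical in
/-- A generator `x_i` with `i ≠ p` translates the first factor, and `x_p` moves only the two
points over `1`. -/
noncomputable def doubleCover (p : ℕ) : FreeGroup ℕ →* Equiv.Perm (FreeGroup ℕ × Bool) :=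
  lift fun i => if i = p then Equiv.swap (1, false) (1, true)
    else Equiv.prodCongr (Equiv.mulLeft (of i)) (Equiv.refl Bool)

theorem doubleCover_fst (p : ℕ) (g : FreeGroup ℕ) :
    ∀ z, (doubleCover p g z).1 = kill p g * z.1 := by
  have hgen : ∀ i z, (doubleCover p (of i) z).1 = kill p (of i) * z.1 := by
    intro i z
    by_cases h : i = p
    · subst h
      rw [kill_self, one_mul, doubleCover, FreeGroup.lift_apply_of, if_pos rfl]
      rw [Equiv.swap_apply_def]
      split_ifs with h1 h2
      · rw [h1]
      · rw [h2]
      · rfl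
    · simp [doubleCover, kill, h]
  induction g using FreeGroup.induction_on with
  | C1 => simp
  | of i => exact hgen i
  | inv_of i _ =>
    intro z
    have := hgen i (doubleCover p (of i)⁻¹ z)
    rw [← Equiv.Perm.mul_apply, ← map_mul, mul_inv_cancel, map_one, Equiv.Perm.one_apply] at this
    rw [this, map_inv (kill p), inv_mul_cancel_left]
  | mul a b ha hb =>
    intro z
    rw [map_mul, Equiv.Perm.mul_apply, ha, hb, map_mul, mul_assoc]

/-- If `kill p g ≠ 1`, then `g` moves `(1, false)` off the fibre over `1`, where `x_p` acts
trivially. Applying `x_p g = g x_p` to `(1, false)` then shows that `g` sends both points over `1`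
to the same point. -/
theorem kill_eq_one_of_conj_eq {p : ℕ} {g : FreeGroup ℕ} (h : g⁻¹ * of p * g = of p) :
    kill p g = 1 := by
  by_contra hne
  have hgen : doubleCover p (of p) = Equiv.swap (1, false) (1, true) := by
    simp [doubleCover]
  have h1 : of p * g = g * of p := by
    rw [mul_assoc, inv_mul_eq_iff_eq_mul] at h
    exact h
  have h2 := congrArg (fun f => doubleCover p f (1, false)) h1
  simp only [map_mul, Equiv.Perm.mul_apply, hgen, Equiv.swap_apply_left] at h2
  have h3 : (doubleCover p g (1, false)).1 ≠ 1 := by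
    rw [doubleCover_fst, mul_one]
    exact hne
  rw [Equiv.swap_apply_of_ne_of_ne (fun h => h3 (by rw [h])) (fun h => h3 (by rw [h]))] at h2
  simpa using (doubleCover p g).injective h2

/-! ### Action of loops and generators modulo the last free generator -/

section Action

variable {G : Type*} [Group G] {m : ℕ} {s : ℕ → G} {θ : G →* MulAut (FreeGroup ℕ)}

open IsBraidSeq

theorem eqOn_initSubgroup (hθ : ∀ k ≤ m, θ (s k) = gen k) {y : G} (hy : y ∈ initSubgroup s m) :
    θ y (of (m + 1)) = of (m + 1) ∧ ∀ u, kill (m + 1) (θ y u) = θ y (kill (m + 1) u) := by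
  induction hy using Subgroup.closure_induction with
  | mem y hy =>
    obtain ⟨k, hk, rfl⟩ := hy
    rw [hθ k hk.le]
    refine ⟨gen_of_ne (by omega) (by omega), fun u => ?_⟩
    refine DFunLike.congr_fun (f := (kill (m + 1)).comp (gen k).toMonoidHom)
      (g := (gen k).toMonoidHom.comp (kill (m + 1))) (FreeGroup.ext_hom _ _ fun i => ?_) u
    simp only [MonoidHom.comp_apply, MulEquiv.toMonoidHom_eq_coe, MonoidHom.coe_coe]
    by_cases h1 : i = k
    · subst h1
      rw [kill_of_ne (by omega), gen_left]
      simp only [map_mul, map_inv]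
      rw [kill_of_ne (by omega), kill_of_ne (by omega)]
    by_cases h2 : i = k + 1
    · subst h2
      rw [gen_right, kill_of_ne (by omega), kill_of_ne (by omega), gen_right]
    by_cases h3 : i = m + 1
    · subst h3
      rw [gen_of_ne h1 h2, kill_self, map_one]
    · rw [gen_of_ne h1 h2, kill_of_ne h3, gen_of_ne h1 h2]
  | one => simp
  | mul a b _ _ ha hb =>
    refine ⟨?_, fun u => ?_⟩
    · rw [map_mul, MulAut.mul_apply, hb.1, ha.1]
    · rw [map_mul, MulAut.mul_apply, MulAut.mul_apply, ha.2, hb.2]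
  | inv a _ ha =>
    refine ⟨?_, fun u => ?_⟩
    · rw [map_inv, MulAut.inv_apply, MulEquiv.symm_apply_eq, ha.1]
    · rw [map_inv, MulAut.inv_apply, MulAut.inv_apply, MulEquiv.eq_symm_apply, ← ha.2,
        MulEquiv.apply_symm_apply]

theorem run_mem_initSubgroup {i d : ℕ} (hd : i + d ≤ m) : run s i d ∈ initSubgroup s m := by
  induction d generalizing i with
  | zero => exact one_mem _
  | succ d ih => exact mul_mem (mem_initSubgroup s (by omega)) (ih (by omega))

theorem run_apply (hθ : ∀ k ≤ m, θ (s k) = gen k) {i d : ℕ} (hd : i + d ≤ m + 1) :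
    θ (run s i d) (of (i + d)) = of i := by
  induction d generalizing i with
  | zero => simp [run]
  | succ d ih =>
    rw [run, map_mul, MulAut.mul_apply, show i + (d + 1) = i + 1 + d by omega, ih (by omega),
      hθ i (by omega), gen_right]

theorem sq_apply (hθ : ∀ k ≤ m, θ (s k) = gen k) :
    θ (s m * s m) (of (m + 1)) = (of m)⁻¹ * of (m + 1) * of m ∧
      ∀ u, kill (m + 1) (θ (s m * s m) u) = kill (m + 1) u := by
  rw [map_mul, hθ m le_rfl]
  refine ⟨by rw [MulAut.mul_apply, gen_right, gen_left], fun u => ?_⟩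
  refine DFunLike.congr_fun (f := (kill (m + 1)).comp (gen m * gen m).toMonoidHom)
    (g := kill (m + 1)) (FreeGroup.ext_hom _ _ fun i => ?_) u
  simp only [MonoidHom.comp_apply, MulEquiv.toMonoidHom_eq_coe, MonoidHom.coe_coe,
    MulAut.mul_apply]
  by_cases h1 : i = m
  · subst h1
    simp only [gen_left, gen_right, map_mul, map_inv, kill_self]
    group
  by_cases h2 : i = m + 1
  · subst h2
    simp only [gen_left, gen_right, map_mul, map_inv, kill_self]
    group
  · rw [gen_of_ne h1 h2, gen_of_ne h1 h2]

theorem loop_apply (hθ : ∀ k ≤ m, θ (s k) = gen k) {i : ℕ} (hi : i ≤ m) :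
    θ (loop s m i) (of (m + 1)) = (of i)⁻¹ * of (m + 1) * of i ∧
      ∀ u, kill (m + 1) (θ (loop s m i) u) = kill (m + 1) u := by
  have hrun : run s i (m - i) ∈ initSubgroup s m := run_mem_initSubgroup (by omega)
  have h1 := eqOn_initSubgroup hθ hrun
  have h2 := eqOn_initSubgroup hθ (inv_mem hrun)
  have h3 := run_apply hθ (i := i) (d := m - i) (by omega)
  rw [show i + (m - i) = m by omega] at h3
  refine ⟨?_, fun u => ?_⟩
  · rw [loop, map_mul, MulAut.mul_apply, h2.1, map_mul, MulAut.mul_apply, (sq_apply hθ).1]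
    simp only [map_mul, map_inv, h3, h1.1]
  · rw [loop, map_mul, MulAut.mul_apply, map_mul, MulAut.mul_apply, h1.2, (sq_apply hθ).2, h2.2,
      ← MulAut.mul_apply, ← map_mul, mul_inv_cancel, map_one, MulAut.one_apply]

/-- The word `w` can be read off from the image of `x_{m+1}`, so the loops generate freely. The
second conjunct makes the conjugators multiply correctly modulo `x_{m+1}`. -/
theorem lift_loop_apply (hθ : ∀ k ≤ m, θ (s k) = gen k) (w : FreeGroup (Fin (m + 1))) :
    (∃ g, θ (lift (fun i : Fin (m + 1) => loop s m i) w) (of (m + 1)) = g⁻¹ * of (m + 1) * g ∧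
      kill (m + 1) g = FreeGroup.map Fin.val w) ∧
      ∀ u, kill (m + 1) (θ (lift (fun i : Fin (m + 1) => loop s m i) w) u) = kill (m + 1) u := by
  induction w using FreeGroup.induction_on with
  | C1 => exact ⟨⟨1, by simp⟩, by simp⟩
  | of i =>
    have h := loop_apply hθ (i := i) (by omega)
    rw [FreeGroup.lift_apply_of]
    exact ⟨⟨of i, h.1, by rw [kill_of_ne (by omega), FreeGroup.map.of]⟩, h.2⟩
  | inv_of i ih =>
    obtain ⟨⟨g, h1, h2⟩, h3⟩ := ih
    have h4 : ∀ u, kill (m + 1)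
        (θ (lift (fun i : Fin (m + 1) => loop s m i) (of i)⁻¹) u) = kill (m + 1) u := by
      intro u
      rw [← h3, map_inv, ← MulAut.mul_apply, ← map_mul, mul_inv_cancel, map_one, MulAut.one_apply]
    refine ⟨⟨(θ (lift (fun i : Fin (m + 1) => loop s m i) (of i)⁻¹) g)⁻¹, ?_, ?_⟩, h4⟩
    · rw [map_inv, map_inv, MulAut.inv_apply, MulEquiv.symm_apply_eq]
      simp only [map_mul, map_inv, h1, MulAut.apply_inv_self]
      group
    · rw [map_inv, h4, h2, map_inv]
  | mul a b ha hb =>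
    obtain ⟨⟨g, h1, h2⟩, h3⟩ := ha
    obtain ⟨⟨g', h1', h2'⟩, h3'⟩ := hb
    -- The action of `a` also transforms the conjugator `g'` of `b`, but not its image under `kill`.
    refine ⟨⟨g * θ (lift (fun i : Fin (m + 1) => loop s m i) a) g', ?_, ?_⟩, fun u => ?_⟩
    · rw [map_mul, map_mul, MulAut.mul_apply, h1']
      simp only [map_mul, map_inv, h1]
      group
    · rw [map_mul, h3, h2, h2', map_mul]
    · rw [map_mul, map_mul, MulAut.mul_apply, h3, h3']

theorem exists_lift_loop {g : G} (hg : g ∈ loopSubgroup s m) :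
    ∃ w, lift (fun i : Fin (m + 1) => loop s m i) w = g := by
  have h : loopSubgroup s m ≤ (lift fun i : Fin (m + 1) => loop s m i).range := by
    refine (Subgroup.closure_le _).2 ?_
    rintro _ ⟨i, hi, rfl⟩
    exact ⟨of ⟨i, by omega⟩, FreeGroup.lift_apply_of⟩
  exact h hg

theorem eq_one_of_mem_loopSubgroup (hθ : ∀ k ≤ m, θ (s k) = gen k) {g : G}
    (hg : g ∈ loopSubgroup s m) (h : θ g (of (m + 1)) = of (m + 1)) : g = 1 := by
  obtain ⟨w, rfl⟩ := exists_lift_loop hg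
  obtain ⟨⟨g, h1, h2⟩, -⟩ := lift_loop_apply hθ w
  rw [kill_eq_one_of_conj_eq (h1.symm.trans h), ← map_one (FreeGroup.map Fin.val)] at h2
  rw [← FreeGroup.map_injective Fin.val_injective h2, map_one]

theorem kill_of_mem_loopSubgroup (hθ : ∀ k ≤ m, θ (s k) = gen k) {g : G}
    (hg : g ∈ loopSubgroup s m) (u : FreeGroup ℕ) : kill (m + 1) (θ g u) = kill (m + 1) u := by
  obtain ⟨w, rfl⟩ := exists_lift_loop hg
  exact (lift_loop_apply hθ w).2 u

theorem kill_apply_last_of_mem_sup (hs : IsBraidSeq m s) (hθ : ∀ k ≤ m, θ (s k) = gen k) {g : G}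
    (hg : g ∈ loopSubgroup s m ⊔ initSubgroup s m) : kill (m + 1) (θ g (of (m + 1))) = 1 := by
  obtain ⟨x, hx, y, hy, rfl⟩ := hs.exists_mul_of_mem_sup hg
  rw [map_mul, MulAut.mul_apply, (eqOn_initSubgroup hθ hy).1, kill_of_mem_loopSubgroup hθ hx,
    kill_self]

theorem mem_sup_of_apply_eq_one (hs : IsBraidSeq m s) (hθ : ∀ k ≤ m, θ (s k) = gen k) {g : G}
    (hg : g ∈ initSubgroup s (m + 1)) (h : θ g = 1) :
    g ∈ loopSubgroup s m ⊔ initSubgroup s m := by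
  obtain ⟨j, hj, hmem⟩ := hs.exists_run_mul hg
  obtain rfl | hj' := eq_or_lt_of_le hj
  · simpa [run] using hmem
  · have h1 := kill_apply_last_of_mem_sup hs hθ (inv_mem hmem)
    have h2 := run_apply hθ (i := j) (d := m + 1 - j) (by omega)
    rw [show j + (m + 1 - j) = m + 1 by omega] at h2
    -- As `g` acts trivially, `g⁻¹ * run s j _` still sends `x_{m+1}` to `x_j`, which survives `kill
    -- (m + 1)` for `j ≤ m`.
    rw [mul_inv_rev, inv_inv, map_mul, map_inv, h, inv_one, one_mul, h2, kill_of_ne hj'.ne] at h1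
    exact absurd h1 (FreeGroup.of_ne_one j)

/-- An element that acts trivially does not involve the last strand. -/
theorem mem_initSubgroup_of_apply_eq_one (hs : IsBraidSeq m s) (hθ : ∀ k ≤ m, θ (s k) = gen k)
    {g : G} (hg : g ∈ initSubgroup s (m + 1)) (h : θ g = 1) : g ∈ initSubgroup s m := by
  obtain ⟨x, hx, y, hy, rfl⟩ := hs.exists_mul_of_mem_sup (mem_sup_of_apply_eq_one hs hθ hg h)
  obtain ⟨hy1, hy2⟩ := eqOn_initSubgroup hθ hy
  have h2 : ∀ u, θ x (θ y u) = u := fun u => by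
    rw [← MulAut.mul_apply, ← map_mul, h, MulAut.one_apply]
  have hx1 : x = 1 := eq_one_of_mem_loopSubgroup hθ hx (by simpa only [hy1] using h2 (of (m + 1)))
  rwa [hx1, one_mul]

end Action

/-! ### Faithfulness of Artin's representation -/

/-- The last generator of `B_n` has index `n - 2`. For `n ≤ 1` the truncated bound `0` imposes no
relation. -/
theorem lift_braidRels {G : Type*} [Group G] {n : ℕ} {s : ℕ → G} (hs : IsBraidSeq (n - 2) s) :
    ∀ r ∈ braidRels n, lift (fun k : Fin (n - 1) => s k) r = 1 := by
  rintro r (⟨i, j, hij, rfl⟩ | ⟨i, j, hij, rfl⟩)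
  · simp only [map_mul, map_inv, FreeGroup.lift_apply_of]
    rw [mul_inv_eq_one, ← hij]
    exact hs.braid i (by omega)
  · simp only [map_mul, map_inv, FreeGroup.lift_apply_of]
    rw [mul_inv_eq_one]
    exact hs.comm i j hij (by omega)

/-- Artin's representation of the braid group. -/
def rep (n : ℕ) : BraidGroup n →* MulAut (FreeGroup ℕ) :=
  PresentedGroup.toGroup (lift_braidRels (isBraidSeq_gen (n - 2)))

theorem rep_sigma {n : ℕ} (k : Fin (n - 1)) : rep n (braidSigma k) = gen k :=
  PresentedGroup.toGroup.of _

/-- The standard generators of the braid group, continued by `1`. -/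
def sigma (n k : ℕ) : BraidGroup n := if h : k < n - 1 then braidSigma ⟨k, h⟩ else 1

theorem sigma_of_lt {n k : ℕ} (h : k < n - 1) : sigma n k = braidSigma ⟨k, h⟩ := dif_pos h

theorem rep_sigma_of_lt {n k : ℕ} (h : k < n - 1) : rep n (sigma n k) = gen k := by
  rw [sigma_of_lt h, rep_sigma]

theorem isBraidSeq_sigma (n : ℕ) : IsBraidSeq (n - 2) (sigma n) where
  braid k hk := by
    rw [sigma_of_lt (show k < n - 1 by omega), sigma_of_lt (show k + 1 < n - 1 by omega)]
    have := PresentedGroup.one_of_mem (rels := braidRels n)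
      (Or.inl ⟨⟨k, by omega⟩, ⟨k + 1, by omega⟩, rfl, rfl⟩)
    rw [map_mul, map_inv, mul_inv_eq_one, map_mul, map_mul, map_mul, map_mul] at this
    exact this
  comm i j hij hj := by
    by_cases h : j < n - 1
    · rw [sigma_of_lt (show i < n - 1 by omega), sigma_of_lt h]
      have := PresentedGroup.one_of_mem (rels := braidRels n)
        (Or.inr ⟨⟨i, by omega⟩, ⟨j, h⟩, hij, rfl⟩)
      rw [map_mul, map_inv, mul_inv_eq_one, map_mul, map_mul] at this
      exact this
    · omega

theorem mem_initSubgroup_sigma {n : ℕ} (b : BraidGroup n) :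
    b ∈ IsBraidSeq.initSubgroup (sigma n) (n - 1) := by
  refine PresentedGroup.generated_by _ _ (fun k => ?_) b
  have := IsBraidSeq.mem_initSubgroup (sigma n) k.2
  rwa [sigma_of_lt k.2] at this

/-- The inclusion of braid groups that adds a strand on the right. -/
def incl (n : ℕ) : BraidGroup n →* BraidGroup (n + 1) :=
  PresentedGroup.toGroup (f := fun k : Fin (n - 1) => sigma (n + 1) k)
    (lift_braidRels (s := sigma (n + 1))
      ⟨fun k hk => (isBraidSeq_sigma (n + 1)).braid k (by omega),
        fun i j hij hj => (isBraidSeq_sigma (n + 1)).comm i j hij (by omega)⟩)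

theorem incl_sigma {n : ℕ} (k : Fin (n - 1)) : incl n (braidSigma k) = sigma (n + 1) k :=
  PresentedGroup.toGroup.of _

/-- All braid groups act on the same `FreeGroup ℕ`, so adding a strand does not change the
automorphism. Injectivity of `incl` is never required. -/
theorem rep_incl {n : ℕ} (b : BraidGroup n) : rep (n + 1) (incl n b) = rep n b := by
  refine DFunLike.congr_fun (f := (rep (n + 1)).comp (incl n)) (PresentedGroup.ext fun k => ?_) b
  change rep (n + 1) (incl n (braidSigma k)) = rep n (braidSigma k)
  rw [incl_sigma, rep_sigma, rep_sigma_of_lt (by omega)]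

theorem rep_of_ge {n i : ℕ} (b : BraidGroup n) (hi : n ≤ i) : rep n b (of i) = of i := by
  have hb := mem_initSubgroup_sigma b
  induction hb using Subgroup.closure_induction with
  | mem y hy =>
    obtain ⟨k, hk, rfl⟩ := hy
    rw [rep_sigma_of_lt hk, gen_of_ne (by omega) (by omega)]
  | one => rw [map_one, MulAut.one_apply]
  | mul a b _ _ ha hb => rw [map_mul, MulAut.mul_apply, hb, ha]
  | inv a _ ha => rw [map_inv, MulAut.inv_apply, MulEquiv.symm_apply_eq, ha]

theorem eq_one_of_le_one {n : ℕ} (hn : n ≤ 1) (b : BraidGroup n) : b = 1 := by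
  have hb := mem_initSubgroup_sigma b
  induction hb using Subgroup.closure_induction with
  | mem y hy =>
    obtain ⟨k, hk, rfl⟩ := hy
    omega
  | one => rfl
  | mul a b _ _ ha hb => rw [ha, hb, mul_one]
  | inv a _ ha => rw [ha, inv_one]

/-- Artin's representation is faithful. -/
theorem eq_one_of_rep_eq_one {n : ℕ} (b : BraidGroup n) (hb : rep n b = 1) : b = 1 := by
  induction n with
  | zero => exact eq_one_of_le_one (by omega) b
  | succ n ih =>
    obtain rfl | hn := Nat.eq_zero_or_pos n
    · exact eq_one_of_le_one le_rfl b
    obtain ⟨m, rfl⟩ : ∃ m, n = m + 1 := ⟨n - 1, by omega⟩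
    have hmem := mem_initSubgroup_of_apply_eq_one (m := m) (isBraidSeq_sigma (m + 1 + 1))
      (fun k hk => rep_sigma_of_lt (by omega)) (mem_initSubgroup_sigma b) hb
    have hle : IsBraidSeq.initSubgroup (sigma (m + 1 + 1)) m ≤ (incl (m + 1)).range := by
      refine (Subgroup.closure_le _).2 ?_
      rintro _ ⟨k, hk, rfl⟩
      exact ⟨braidSigma ⟨k, hk⟩, incl_sigma _⟩
    obtain ⟨c, rfl⟩ := hle hmem
    rw [rep_incl] at hb
    rw [ih c hb, map_one]

end Artin

/-! ### Comparison with the representation of a pointed quandle -/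

namespace QuandlePower

open Quandles

variable {Q : Type u} [Quandle Q] {n : ℕ}

/-- The morphism to the free group, as a conjugation quandle, that sends the whole `i`-th copy to
the `i`-th generator. -/
def toFreeGroup (Q : Type u) [Quandle Q] (n : ℕ) :
    QuandlePower Q n →◃ Quandle.Conj (FreeGroup ℕ) :=
  QuandleFreeProd.lift fun i =>
    { toFun := fun _ => (FreeGroup.of (i : ℕ) : FreeGroup ℕ)
      map_act' := fun {_ _} => (Quandle.fix (α := Quandle.Conj (FreeGroup ℕ))).symm }

theorem toFreeGroup_copy (i : Fin n) (q : Q) :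
    toFreeGroup Q n (copy i q) = (FreeGroup.of (i : ℕ) : FreeGroup ℕ) := rfl

theorem toFreeGroup_tauHom (h : Q) (k : Fin (n - 1)) (x : QuandlePower Q n) :
    toFreeGroup Q n (tauHom h k x) = Artin.gen k (toFreeGroup Q n x : FreeGroup ℕ) := by
  refine hom_ext ((toFreeGroup Q n).comp (tauHom h k))
    ((Quandle.Conj.map (Artin.gen k).toMonoidHom).comp (toFreeGroup Q n)) (fun i q => ?_) x
  change toFreeGroup Q n (tauHom h k (copy i q)) = Artin.gen k (FreeGroup.of (i : ℕ))
  by_cases h1 : i = lo k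
  · subst h1
    rw [tauHom_lo, QuandleFreeProd.map_invAct, toFreeGroup_copy, toFreeGroup_copy]
    exact (Artin.gen_left k).symm
  by_cases h2 : i = hi k
  · subst h2
    -- The element `h_k ◃ q_k` stays in the `k`-th copy, which collapses to `x_k`.
    rw [tauHom_hi, ← copy_act, toFreeGroup_copy]
    exact (Artin.gen_right k).symm
  · rw [tauHom_ne h k q i h1 h2, toFreeGroup_copy]
    exact (Artin.gen_of_ne (fun e => h1 (Fin.ext e)) (fun e => h2 (Fin.ext e))).symm

theorem toFreeGroup_rep (h : Q) (b : BraidGroup n) (x : QuandlePower Q n) :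
    toFreeGroup Q n ((pointedQuandleRep h n b).1 x) =
      Artin.rep n b (toFreeGroup Q n x : FreeGroup ℕ) := by
  have hb := Artin.mem_initSubgroup_sigma b
  induction hb using Subgroup.closure_induction generalizing x with
  | mem y hy =>
    obtain ⟨k, hk, rfl⟩ := hy
    rw [Artin.rep_sigma_of_lt hk, Artin.sigma_of_lt hk, pointedQuandleRep_sigma]
    exact toFreeGroup_tauHom h ⟨k, hk⟩ x
  | one => simp
  | mul a b _ _ ha hb =>
    rw [map_mul, map_mul, MulAut.mul_apply, ← hb, ← ha]
    rfl
  | inv a _ ha =>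
    rw [map_inv, map_inv, MulAut.inv_apply, MulEquiv.eq_symm_apply, ← ha]
    congr 1
    exact Equiv.apply_symm_apply _ _

end QuandlePower

theorem proposition2 {Q : Type u} [Quandle Q] (h : Q) (n : ℕ) :
    Function.Injective (pointedQuandleRep h n) := by
  refine (injective_iff_map_eq_one _).2 fun b hb => Artin.eq_one_of_rep_eq_one b ?_
  have hfix : ∀ i : Fin n, Artin.rep n b (FreeGroup.of (i : ℕ)) = FreeGroup.of (i : ℕ) := by
    intro i
    -- Any element of the `i`-th copy would do; `h` provides one.
    have := QuandlePower.toFreeGroup_rep h b (QuandlePower.copy i h)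
    rw [hb] at this
    exact this.symm
  refine Artin.mulAut_ext fun i => ?_
  by_cases hi : i < n
  · exact hfix ⟨i, hi⟩
  · exact Artin.rep_of_ge b (not_lt.1 hi)
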